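/- Let $A_l\in\mathbb{R}^{m_l\times n_x}$, $A_f\in\mathbb{R}^{m_f\times n_x}$, $B_f\in\mathbb{R}^{m_f\times n_y}$, $b_l\in\mathbb{R}^{m_l}$, $b_f\in\mathbb{R}^{m_f}$, $d_1\in\mathbb{R}^{n_x}$, $d_2\in\mathbb{R}^{n_y}$, and suppose that $$D=\{(x,y)\in\mathbb{R}^{n_x}\times\mathbb{R}^{n_y} : A_l x\le b_l,\ A_f x+B_f y\le b_f\}$$ is compact and has nonempty interior. Let $\pi(x,y)=x$ and $X=\pi(D)$. For $x\in X$ the chamber of $x$ is $\sigma(x)=\bigcap\{\pi(F): F \text{ a face of } D,\ x\in\pi(F)\}$, where a face of $D$ is the set of maximizers over $D$ of a linear function, and the chamber complex of $D$ is $\mathscr{C}(D)=\{\sigma(x):x\in X\}$. A function $f:X\to\mathbb{R}$ is called piecewise linear over $\mathscr{C}(D)$ if $\mathscr{C}(D)$ is finite and there are $(d_C,a_C)\in\mathbb{R}^{n_x}\times\mathbb{R}$, $C\in\mathscr{C}(D)$, such that $$f(x)=\sum_{C\in\mathscr{C}(D)}(\langle d_C,x\rangle+a_C)\,\mathbf{1}_{\mathrm{ri}(C)}(x)\qquad\text{for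 all }x\in X,$$ where $\mathrm{ri}$ denotes the relative interior. Let $c$ be a random vector with values in the unit sphere $\mathbb{S}_{n_y}$ of $\mathbb{R}^{n_y}$ whose distribution is nonatomic, in the sense that $\mathbb{P}[c\in O]=0$ for every Borel set $O\subseteq\mathbb{S}_{n_y}$ with $\mathcal{H}^{n_y-1}(O)=0$, where $\mathcal{H}^{n_y-1}$ is the $(n_y-1)$-dimensional Hausdorff measure. Let $N\ge 1$ and let $\hat c_1,\dots,\hat c_N$ be an independent sample of $c$. Then, with probability $1$: for every $i\in\{1,\dots,N\}$ and every $x\in X$ the problem $\min_y\{\langle\hat c_i,y\rangle : A_f x+B_f y\le b_f\}$ has exactly one solution $y_i(x)$, so that the function $$\theta:X\to\mathbb{R},\qquad \theta(x)=\langle d_1,x\rangle+\frac1N\sum_{i=1}^N\langle d_2,y_i(x)\rangle$$ is well defined; and $\theta$ is piecewise linear over $\mathscr{C}(D)$. -/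

import Mathlib

open MeasureTheory ProbabilityTheory

noncomputable section

/-- Data of a linear bilevel problem: leader constraints `Al x ≤ bl`, follower constraints
`Af x + Bf y ≤ bf`, and leader cost `⟨d1, x⟩ + ⟨d2, y⟩`. -/
structure BilevelData (nx ny ml mf : ℕ) where
  Al : Matrix (Fin ml) (Fin nx) ℝ
  Af : Matrix (Fin mf) (Fin nx) ℝ
  Bf : Matrix (Fin mf) (Fin ny) ℝ
  bl : Fin ml → ℝ
  bf : Fin mf → ℝ
  d1 : EuclideanSpace ℝ (Fin nx)
  d2 : EuclideanSpace ℝ (Fin ny)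

namespace BilevelData

variable {nx ny ml mf : ℕ}

/-- The follower's feasible set `{y : Af x + Bf y ≤ bf}`. -/
def followerSet (P : BilevelData nx ny ml mf) (x : EuclideanSpace ℝ (Fin nx)) :
    Set (EuclideanSpace ℝ (Fin ny)) :=
  {y | P.Af.mulVec x.ofLp + P.Bf.mulVec y.ofLp ≤ P.bf}

/-- The feasible set `D` of the high-point relaxation: all the constraints, of the leader and of
the follower, imposed on `(x, y)`. -/
def highPoint (P : BilevelData nx ny ml mf) :
    Set (EuclideanSpace ℝ (Fin nx) × EuclideanSpace ℝ (Fin ny)) :=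
  {p | P.Al.mulVec p.1.ofLp ≤ P.bl ∧ P.Af.mulVec p.1.ofLp + P.Bf.mulVec p.2.ofLp ≤ P.bf}

/-- The solution set of the follower's problem
`min {⟨c, y⟩ : Af x + Bf y ≤ bf}` for the leader's decision `x` and the cost vector `c`. -/
def followerArgmin (P : BilevelData nx ny ml mf) (c : EuclideanSpace ℝ (Fin ny))
    (x : EuclideanSpace ℝ (Fin nx)) : Set (EuclideanSpace ℝ (Fin ny)) :=
  {y | y ∈ P.followerSet x ∧ ∀ z ∈ P.followerSet x, inner ℝ c y ≤ inner ℝ c z}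

end BilevelData

section Chambers

variable {nx ny : ℕ}

/-- The projection `X = π(D)` of `D` to the space of the leader. -/
def leaderSet (D : Set (EuclideanSpace ℝ (Fin nx) × EuclideanSpace ℝ (Fin ny))) :
    Set (EuclideanSpace ℝ (Fin nx)) :=
  Prod.fst '' D

/-- The chamber `σ(x)`: the intersection of the projections `π(F)` that contain `x`, where `F` runs
over the faces of `D`. A face is the set of maximizers over `D` of a linear function, i.e. an
exposed subset; `IsExposed` also admits the empty set, which never has `x` in its projection. -/
def chamber (D : Set (EuclideanSpace ℝ (Fin nx) × EuclideanSpace ℝ (Fin ny)))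
    (x : EuclideanSpace ℝ (Fin nx)) : Set (EuclideanSpace ℝ (Fin nx)) :=
  ⋂₀ {Q | ∃ F, IsExposed ℝ D F ∧ Q = Prod.fst '' F ∧ x ∈ Q}

/-- The chamber complex `{σ(x) : x ∈ X}`. -/
def chamberComplex (D : Set (EuclideanSpace ℝ (Fin nx) × EuclideanSpace ℝ (Fin ny))) :
    Set (Set (EuclideanSpace ℝ (Fin nx))) :=
  chamber D '' leaderSet D

/-- `f : X → ℝ` is piecewise linear over the chamber complex: the complex is finite and, for some
`d_C` and `a_C`, `f(x) = ∑_C (⟨d_C, x⟩ + a_C) 1_{ri C}(x)` for all `x ∈ X`. -/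
def IsPiecewiseLinearOverChambers
    (D : Set (EuclideanSpace ℝ (Fin nx) × EuclideanSpace ℝ (Fin ny)))
    (f : leaderSet D → ℝ) : Prop :=
  (chamberComplex D).Finite ∧
    ∃ (d : Set (EuclideanSpace ℝ (Fin nx)) → EuclideanSpace ℝ (Fin nx))
      (a : Set (EuclideanSpace ℝ (Fin nx)) → ℝ),
      ∀ x : leaderSet D,
        f x = ∑ᶠ C ∈ chamberComplex D,
          (intrinsicInterior ℝ C).indicator
            (fun z : EuclideanSpace ℝ (Fin nx) => inner ℝ (d C) z + a C)
            (x : EuclideanSpace ℝ (Fin nx))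

end Chambers

/-- The random unit vector `c` has a nonatomic distribution: it gives probability zero to every
Borel subset of the sphere that is null for the `(n - 1)`-dimensional Hausdorff measure. -/
def HasNonatomicDistribution {n : ℕ} {Ω : Type*} [MeasurableSpace Ω] (μ : Measure Ω)
    (c : Ω → Metric.sphere (0 : EuclideanSpace ℝ (Fin n)) 1) : Prop :=
  ∀ O : Set (Metric.sphere (0 : EuclideanSpace ℝ (Fin n)) 1), MeasurableSet O →
    Measure.hausdorffMeasure ((n : ℝ) - 1) O = 0 → μ (c ⁻¹' O) = 0

end

/-! Write `D` as a polyhedron. Its nonempty faces are the sets where some family `J` of constraints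
is tight (`isExposed_polyhedronFace`, `IsExposed.exists_eq_polyhedronFace`), so a chamber is
determined by finitely many yes/no conditions.

Almost surely every cost is generic: a cost that fails for some `J` lies in a fixed great subsphere,
which is null, and there are finitely many `J`. For a generic cost the constraints active at a
minimizer determine `y` from `x`. Hence minimizers are unique, and affine in `x` as long as the
active constraints stay tight.

If `x` and `x₀` have the same chamber, some point above `x` lies on the face active at the minimizer
above `x₀`. By `mem_fiberArgmin_of_mem_polyhedronFace` it is optimal, so a single affine formula
serves all such `x`.

The indicator sum then needs `x` to lie in the relative interior of its own chamber and of no other: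
`mem_intrinsicInterior_chamber_polyhedron` and `chamber_eq_of_mem_intrinsicInterior`. -/

open Filter Topology

/-! ### Relative interiors of convex sets -/

section RelativeInterior

variable {E : Type*} [NormedAddCommGroup E] [NormedSpace ℝ E]

/-- A segment ending at a relative interior point can be prolonged within the set. -/
lemma exists_pos_add_smul_sub_mem_of_mem_intrinsicInterior {C : Set E} {x q : E}
    (hx : x ∈ intrinsicInterior ℝ C) (hq : q ∈ C) :
    ∃ ε : ℝ, 0 < ε ∧ x + ε • (x - q) ∈ C := by
  obtain ⟨x', hx', rfl⟩ := mem_intrinsicInterior.1 hx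
  let q' : affineSpan ℝ C := ⟨q, subset_affineSpan ℝ C hq⟩
  have hmem : ∀ ε : ℝ, (x' : E) + ε • ((x' : E) - q) ∈ affineSpan ℝ C := fun ε => by
    have h := AffineMap.lineMap_mem (1 + ε) q'.2 x'.2
    rw [AffineMap.lineMap_apply_module'] at h
    convert h using 1
    simp only [q']
    module
  let γ : ℝ → affineSpan ℝ C := fun ε => ⟨(x' : E) + ε • ((x' : E) - q), hmem ε⟩
  have hγ : Continuous γ := by
    apply Continuous.subtype_mk
    fun_prop
  have hγ0 : γ 0 = x' := by ext; simp [γ]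
  have hnhds : ∀ᶠ ε in 𝓝 (0 : ℝ), γ ε ∈ ((↑) ⁻¹' C : Set (affineSpan ℝ C)) := by
    apply hγ.continuousAt
    rw [hγ0]
    exact mem_interior_iff_mem_nhds.1 hx'
  obtain ⟨ε, hε, hpos⟩ :=
    ((hnhds.filter_mono nhdsWithin_le_nhds).and self_mem_nhdsWithin : ∀ᶠ ε in 𝓝[>] (0 : ℝ),
      γ ε ∈ ((↑) ⁻¹' C : Set (affineSpan ℝ C)) ∧ ε ∈ Set.Ioi 0).exists
  exact ⟨ε, hpos, hε⟩

/-- A point of a convex set from which every segment can be prolonged is a relative interior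
point. -/
lemma mem_intrinsicInterior_of_forall_exists [FiniteDimensional ℝ E] {C : Set E}
    (hC : Convex ℝ C) {x : E} (hx : x ∈ C)
    (h : ∀ q ∈ C, ∃ ε : ℝ, 0 < ε ∧ x + ε • (x - q) ∈ C) :
    x ∈ intrinsicInterior ℝ C := by
  obtain ⟨q, hq⟩ := Set.Nonempty.intrinsicInterior hC ⟨x, hx⟩
  obtain ⟨ε, hε, hz⟩ := h q (intrinsicInterior_subset hq)
  obtain ⟨q', hq', rfl⟩ := mem_intrinsicInterior.1 hq
  set z := x + ε • (x - (q' : E)) with hzdef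
  refine mem_intrinsicInterior.2 ⟨⟨x, subset_affineSpan ℝ C hx⟩, ?_, rfl⟩
  rw [mem_interior_iff_mem_nhds]
  -- The homothety of centre `z` and ratio `r` sends `x` to `q'`, hence points of the affine span
  -- near `x` into `C`; such a point lies between `z` and its image.
  set r : ℝ := (1 + ε) / ε with hr
  let φ : affineSpan ℝ C → affineSpan ℝ C := fun w =>
    ⟨AffineMap.lineMap z (w : E) r, AffineMap.lineMap_mem r (subset_affineSpan ℝ C hz) w.2⟩
  have hφ : Continuous φ := by
    apply Continuous.subtype_mk
    simp only [AffineMap.lineMap_apply_module']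
    fun_prop
  have hφx : φ ⟨x, subset_affineSpan ℝ C hx⟩ = q' := by
    ext
    simp only [φ, AffineMap.lineMap_apply_module', hzdef]
    have h1 : r * ε = 1 + ε := by rw [hr]; field_simp
    calc r • (x - (x + ε • (x - (q' : E)))) + (x + ε • (x - (q' : E)))
        = x + (ε - r * ε) • (x - (q' : E)) := by module
      _ = q' := by rw [h1]; module
  have hev : ∀ᶠ w in 𝓝 (⟨x, subset_affineSpan ℝ C hx⟩ : affineSpan ℝ C),
      φ w ∈ ((↑) ⁻¹' C : Set (affineSpan ℝ C)) := by
    apply hφ.continuousAt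
    rw [hφx]
    exact mem_interior_iff_mem_nhds.1 hq'
  filter_upwards [hev] with w hw
  have hw' : AffineMap.lineMap z (w : E) r ∈ C := hw
  have hcomb := hC hz hw' (a := 1 / (1 + ε)) (b := ε / (1 + ε)) (by positivity) (by positivity)
    (by field_simp)
  suffices heq : (w : E) = (1 / (1 + ε)) • z + (ε / (1 + ε)) • AffineMap.lineMap z (w : E) r by
    rwa [← heq] at hcomb
  rw [AffineMap.lineMap_apply_module', hr]
  have h2 : ε / (1 + ε) * ((1 + ε) / ε) = 1 := by field_simp
  have h3 : 1 / (1 + ε) + ε / (1 + ε) = 1 := by field_simp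
  calc (w : E) = (1 : ℝ) • ((w : E) - z) + (1 : ℝ) • z := by module
    _ = (ε / (1 + ε) * ((1 + ε) / ε)) • ((w : E) - z) + (1 / (1 + ε) + ε / (1 + ε)) • z := by
        rw [h2, h3]
    _ = _ := by module

end RelativeInterior

/-! ### Polyhedra and their faces -/

section Polyhedron

variable {K V : Type*} [NormedAddCommGroup V] [NormedSpace ℝ V]

/-- The solution set of the linear inequalities `g k p ≤ b k`. -/
def polyhedron (g : K → V →L[ℝ] ℝ) (b : K → ℝ) : Set V :=
  {p | ∀ k, g k p ≤ b k}

/-- The part of a polyhedron where the inequalities with index in `J` are equalities. -/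
def polyhedronFace (g : K → V →L[ℝ] ℝ) (b : K → ℝ) (J : Set K) : Set V :=
  {p | p ∈ polyhedron g b ∧ ∀ k ∈ J, g k p = b k}

/-- The indices of the inequalities that are equalities at `p`. -/
def activeSet (g : K → V →L[ℝ] ℝ) (b : K → ℝ) (p : V) : Set K :=
  {k | g k p = b k}

variable {g : K → V →L[ℝ] ℝ} {b : K → ℝ}

lemma mem_polyhedronFace_activeSet {p : V} (hp : p ∈ polyhedron g b) :
    p ∈ polyhedronFace g b (activeSet g b p) :=
  ⟨hp, fun _ hk => hk⟩

lemma convex_polyhedron : Convex ℝ (polyhedron g b) := by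
  intro p hp q hq s t hs ht hst k
  have h1 := mul_le_mul_of_nonneg_left (hp k) hs
  have h2 := mul_le_mul_of_nonneg_left (hq k) ht
  simp only [map_add, map_smul, smul_eq_mul]
  calc s * g k p + t * g k q ≤ s * b k + t * b k := add_le_add h1 h2
    _ = b k := by rw [← add_mul, hst, one_mul]

lemma convex_polyhedronFace (J : Set K) : Convex ℝ (polyhedronFace g b J) := by
  intro p hp q hq s t hs ht hst
  refine ⟨convex_polyhedron hp.1 hq.1 hs ht hst, fun k hk => ?_⟩
  simp only [map_add, map_smul, smul_eq_mul, hp.2 k hk, hq.2 k hk]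
  rw [← add_mul, hst, one_mul]

/-- A direction that does not increase the active constraints is feasible for a short time. -/
lemma eventually_add_smul_mem_polyhedron [Finite K] {p w : V} (hp : p ∈ polyhedron g b)
    (hw : ∀ k ∈ activeSet g b p, g k w ≤ 0) :
    ∀ᶠ ε in 𝓝[>] (0 : ℝ), p + ε • w ∈ polyhedron g b := by
  refine eventually_all.2 fun k => ?_
  rcases (hp k).eq_or_lt with hk | hk
  · filter_upwards [self_mem_nhdsWithin] with ε hε
    have : ε * g k w ≤ 0 := mul_nonpos_of_nonneg_of_nonpos (le_of_lt hε) (hw k hk)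
    simp only [map_add, map_smul, smul_eq_mul]
    linarith
  · have hcont : Continuous fun ε : ℝ => g k (p + ε • w) := by fun_prop
    have h0 : g k (p + (0 : ℝ) • w) < b k := by simpa using hk
    exact (((hcont.tendsto 0).eventually_lt_const h0).filter_mono nhdsWithin_le_nhds).mono
      fun ε hε => hε.le

/-- A segment from a point of a polyhedral face to a point whose active constraints are those of
the face can be prolonged within the face. -/
lemma eventually_add_smul_sub_mem_polyhedronFace [Finite K] {p q : V}
    (hp : p ∈ polyhedron g b) (hq : q ∈ polyhedronFace g b (activeSet g b p)) :
    ∀ᶠ ε in 𝓝[>] (0 : ℝ), p + ε • (p - q) ∈ polyhedronFace g b (activeSet g b p) := by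
  have hd : ∀ k ∈ activeSet g b p, g k (p - q) = 0 := fun k hk => by
    rw [map_sub, hq.2 k hk, sub_eq_zero]
    exact hk
  filter_upwards [eventually_add_smul_mem_polyhedron hp fun k hk => (hd k hk).le] with ε hε
  refine ⟨hε, fun k hk => ?_⟩
  rw [map_add, map_smul, hd k hk, smul_zero, add_zero]
  exact hk

/-- The sum of the `g k` over `J` exposes the face: it is at most the sum of the `b k`, with
equality only if each constraint in `J` is tight. -/
lemma isExposed_polyhedronFace [Finite K] (J : Set K) :
    IsExposed ℝ (polyhedron g b) (polyhedronFace g b J) := by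
  classical
  have := Fintype.ofFinite K
  rintro ⟨p₀, hp₀⟩
  refine ⟨∑ k ∈ J.toFinset, g k, Set.ext fun p => ⟨fun hp => ⟨hp.1, fun q hq => ?_⟩, fun hp => ?_⟩⟩
  · simp only [sum_apply]
    refine Finset.sum_le_sum fun k hk => ?_
    rw [hp.2 k (Set.mem_toFinset.1 hk)]
    exact hq k
  · refine ⟨hp.1, fun k hk => ?_⟩
    have hle := hp.2 p₀ hp₀.1
    simp only [sum_apply] at hle
    have hpt : ∀ k ∈ J.toFinset, g k p ≤ g k p₀ := fun k hk => by
      rw [hp₀.2 k (Set.mem_toFinset.1 hk)]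
      exact hp.1 k
    have heq := (Finset.sum_eq_sum_iff_of_le hpt).1 (le_antisymm (Finset.sum_le_sum hpt) hle)
    rw [heq k (Set.mem_toFinset.2 hk), hp₀.2 k hk]

/-- Take a point of `F` with minimal active set. A midpoint argument shows that these constraints
are tight on all of `F`; conversely, prolonging a segment beyond that point shows that the exposing
functional is no smaller at its other end. -/
lemma IsExposed.exists_eq_polyhedronFace [Finite K] {F : Set V}
    (hF : IsExposed ℝ (polyhedron g b) F) (hne : F.Nonempty) :
    ∃ J, F = polyhedronFace g b J := by
  have hconv : Convex ℝ F := hF.convex convex_polyhedron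
  obtain ⟨_, ⟨⟨p₀, hp₀, rfl⟩, hmin⟩⟩ :=
    (Set.toFinite (activeSet g b '' F)).exists_minimal (hne.image _)
  obtain ⟨l, rfl⟩ := hF hne
  refine ⟨activeSet g b p₀, Set.Subset.antisymm (fun q hq => ⟨hq.1, ?_⟩) fun q hq => ?_⟩
  · have hm := hconv hp₀ hq (a := 1 / 2) (b := 1 / 2) (by norm_num) (by norm_num) (by norm_num)
    have hact : ∀ k, k ∈ activeSet g b ((1 / 2 : ℝ) • p₀ + (1 / 2 : ℝ) • q) →
        g k p₀ = b k ∧ g k q = b k := fun k hk => by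
      have h1 := hp₀.1 k
      have h2 := hq.1 k
      simp only [activeSet, Set.mem_ofPred_eq, map_add, map_smul, smul_eq_mul] at hk
      constructor <;> linarith
    have hsub := hmin (Set.mem_image_of_mem _ hm) fun k hk => (hact k hk).1
    exact fun k hk => (hact k (hsub hk)).2
  · obtain ⟨ε, hε, hpos⟩ :=
      ((eventually_add_smul_sub_mem_polyhedronFace hp₀.1 hq).and self_mem_nhdsWithin).exists
    have hle := hp₀.2 _ hε.1
    have hpos' : (0 : ℝ) < ε := hpos
    simp only [map_add, map_smul, map_sub, smul_eq_mul] at hle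
    have : l p₀ ≤ l q := by
      by_contra! hlt
      have := mul_pos hpos' (sub_pos.2 hlt)
      linarith
    exact ⟨hq.1, fun r hr => (hp₀.2 r hr).trans this⟩

end Polyhedron

/-! ### Parametric linear programs -/

section Parametric

variable {K E F : Type*} [NormedAddCommGroup E] [NormedSpace ℝ E]
  [NormedAddCommGroup F] [NormedSpace ℝ F]
  {g : K → (E × F) →L[ℝ] ℝ} {b : K → ℝ}

/-- The minimizers of `l` over the fiber of a polyhedron above `x`. -/
def fiberArgmin (g : K → (E × F) →L[ℝ] ℝ) (b : K → ℝ) (l : F →L[ℝ] ℝ) (x : E) : Set F :=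
  {y | (x, y) ∈ polyhedron g b ∧ ∀ z, (x, z) ∈ polyhedron g b → l y ≤ l z}

lemma fiberArgmin_nonempty (hD : IsCompact (polyhedron g b)) (l : F →L[ℝ] ℝ) {x : E}
    (hx : x ∈ Prod.fst '' polyhedron g b) : (fiberArgmin g b l x).Nonempty := by
  obtain ⟨⟨x₁, y₀⟩, hp₀, hx₁⟩ := hx
  change x₁ = x at hx₁
  subst x₁
  have hS : IsCompact (polyhedron g b ∩ Prod.fst ⁻¹' {x}) :=
    hD.inter_right (isClosed_singleton.preimage continuous_fst)
  obtain ⟨⟨x₁, y⟩, ⟨hp, hx₁⟩, hmin⟩ := hS.exists_isMinOn ⟨(x, y₀), hp₀, rfl⟩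
    (f := fun p => l p.2) (by fun_prop)
  change x₁ = x at hx₁
  subst x₁
  exact ⟨y, hp, fun z hz => hmin (show (x, z) ∈ _ from ⟨hz, rfl⟩)⟩

/-- Optimality depends on the active constraints only: a point of the polyhedron at which all the
constraints active at an optimal point are active is itself optimal in its own fiber. -/
lemma mem_fiberArgmin_of_mem_polyhedronFace [Finite K] {l : F →L[ℝ] ℝ} {x z : E} {y w : F}
    (hy : y ∈ fiberArgmin g b l x)
    (hw : (z, w) ∈ polyhedronFace g b (activeSet g b (x, y))) :
    w ∈ fiberArgmin g b l z := by
  refine ⟨hw.1, fun v hv => ?_⟩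
  -- The constraints active at `(x, y)` are tight at `(z, w)`, so an improving direction at `w`
  -- would also be feasible and improving at `y`.
  obtain ⟨ε, hε, hpos⟩ := ((eventually_add_smul_mem_polyhedron (w := ((0 : E), v - w)) hy.1
    fun k hk => by
      have h : ((0 : E), v - w) = (z, v) - (z, w) := by simp
      rw [h, map_sub, hw.2 k hk, sub_nonpos]
      exact hv k).and self_mem_nhdsWithin).exists
  have hpos' : (0 : ℝ) < ε := hpos
  have hle := hy.2 (y + ε • (v - w)) (by simpa using hε)
  simp only [map_add, map_smul, map_sub, smul_eq_mul] at hle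
  by_contra! hlt
  have := mul_pos hpos' (sub_pos.2 hlt)
  linarith

/-- If `x` lies strictly between `x'` and a point `z` that belongs to the projection of every face
whose projection contains `x'`, then `x'` belongs to the projection of every face whose projection
contains `x`. -/
lemma mem_image_fst_polyhedronFace_of_prolongation [Finite K] (hD : IsCompact (polyhedron g b))
    {x x' : E} (hx' : x' ∈ Prod.fst '' polyhedron g b) {ε : ℝ} (hε : 0 < ε)
    (hz : ∀ J, x' ∈ Prod.fst '' polyhedronFace g b J →
      x + ε • (x - x') ∈ Prod.fst '' polyhedronFace g b J)
    {J : Set K} (hxJ : x ∈ Prod.fst '' polyhedronFace g b J) :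
    x' ∈ Prod.fst '' polyhedronFace g b J := by
  classical
  have := Fintype.ofFinite K
  set z := x + ε • (x - x') with hzdef
  obtain ⟨⟨x₁, y⟩, hy, hx₁⟩ := hxJ
  change x₁ = x at hx₁
  subst x₁
  obtain ⟨G, hG⟩ : ∃ G : E × F →L[ℝ] ℝ, ∀ p, G p = ∑ k ∈ J.toFinset, g k p :=
    ⟨∑ k ∈ J.toFinset, g k, fun p => sum_apply _ _ _⟩
  obtain ⟨β, hβ⟩ : ∃ β : ℝ, β = ∑ k ∈ J.toFinset, b k := ⟨_, rfl⟩
  have hGle : ∀ p ∈ polyhedron g b, G p ≤ β := fun p hp => by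
    rw [hG, hβ]
    exact Finset.sum_le_sum fun k _ => hp k
  have hGeq : G (x, y) = β := by
    rw [hG, hβ]
    exact Finset.sum_congr rfl fun k hk => hy.2 k (Set.mem_toFinset.1 hk)
  -- Minimizing `l` on a fiber maximizes `G`; the face `J` meets the fiber above `x'` exactly when
  -- this maximum is `β`.
  let l : F →L[ℝ] ℝ := -(G.comp (ContinuousLinearMap.inr ℝ _ _))
  have hGl : ∀ u v, G (u, v) = G (u, 0) - l v := fun u v => by
    have : ((u, v) : E × F) = (u, 0) + (0, v) := by
      simp
    rw [this, map_add]
    simp [l]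
  obtain ⟨y', hy'⟩ := fiberArgmin_nonempty hD l hx'
  have hp' := mem_polyhedronFace_activeSet hy'.1
  obtain ⟨⟨z₁, yz⟩, hyz, hz₁⟩ := hz _ ⟨_, hp', rfl⟩
  change z₁ = z at hz₁
  subst z₁
  -- The combination lies above `x` on the face active at the optimal `(x', y')`, so it is optimal
  -- and `G` equals `β` there. As `G ≤ β` at `(z, yz)`, also `G (x', y') = β`.
  have hcomb := convex_polyhedronFace _ hyz hp'
    (show (0 : ℝ) ≤ 1 / (1 + ε) by positivity) (show (0 : ℝ) ≤ ε / (1 + ε) by positivity)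
    (by field_simp)
  have hfst : (1 / (1 + ε)) • z + (ε / (1 + ε)) • x' = x := by
    have h1 : 1 / (1 + ε) * (1 + ε) = 1 := by field_simp
    calc (1 / (1 + ε)) • z + (ε / (1 + ε)) • x'
        = (1 / (1 + ε) * (1 + ε)) • x + (ε / (1 + ε) - 1 / (1 + ε) * ε) • x' := by
          rw [hzdef]; module
      _ = x := by rw [h1, one_div_mul_eq_div, sub_self]; module
  set w := (1 / (1 + ε)) • yz + (ε / (1 + ε)) • y' with hw
  have hpt : (1 / (1 + ε)) • (z, yz) + (ε / (1 + ε)) • (x', y') = (x, w) := by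
    rw [Prod.smul_mk, Prod.smul_mk, Prod.mk_add_mk, hfst]
  rw [hpt] at hcomb
  have hopt := (mem_fiberArgmin_of_mem_polyhedronFace hy' hcomb).2 y hy.1
  have hGw : β ≤ G (x, w) := by
    rw [← hGeq, hGl x y, hGl x w]
    linarith
  rw [← hpt, map_add, map_smul, map_smul, smul_eq_mul, smul_eq_mul] at hGw
  have hGz := hGle _ hyz.1
  have hG' : β ≤ G (x', y') := by
    have h1 : 0 < 1 + ε := by linarith
    have h2 : β * (1 + ε) ≤ G (z, yz) + ε * G (x', y') := by
      calc β * (1 + ε) ≤ (1 / (1 + ε) * G (z, yz) + ε / (1 + ε) * G (x', y')) * (1 + ε) :=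
            mul_le_mul_of_nonneg_right hGw h1.le
        _ = _ := by field_simp
    exact le_of_mul_le_mul_left (by linarith) hε
  refine ⟨(x', y'), ⟨hy'.1, fun k hk => ?_⟩, rfl⟩
  have hle : ∀ k ∈ J.toFinset, g k (x', y') ≤ b k := fun k _ => hy'.1 k
  refine (Finset.sum_eq_sum_iff_of_le hle).1 (le_antisymm (Finset.sum_le_sum hle) ?_) k
    (Set.mem_toFinset.2 hk)
  rwa [hG, hβ] at hG'

/-- The functional `l` is not constant along any nontrivial space of directions in `F` cut out by
some of the constraints. -/
def IsGenericObjective (g : K → (E × F) →L[ℝ] ℝ) (l : F →L[ℝ] ℝ) : Prop :=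
  ∀ J : Set K, (∃ v : F, v ≠ 0 ∧ ∀ k ∈ J, g k (0, v) = 0) →
    ∃ v : F, (∀ k ∈ J, g k (0, v) = 0) ∧ l v ≠ 0

/-- At a minimizer of a generic functional, the active constraints determine the point in its
fiber. -/
lemma IsGenericObjective.eq_zero_of_activeSet [Finite K] {l : F →L[ℝ] ℝ}
    (hl : IsGenericObjective g l) {x : E} {y v : F} (hy : y ∈ fiberArgmin g b l x)
    (hv : ∀ k ∈ activeSet g b (x, y), g k (0, v) = 0) : v = 0 := by
  by_contra hv0
  obtain ⟨w, hw, hlw⟩ := hl _ ⟨v, hv0, hv⟩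
  -- Applied to both `w` and `-w`, this forces `l w = 0`.
  have key : ∀ u : F, (∀ k ∈ activeSet g b (x, y), g k (0, u) = 0) → 0 ≤ l u := fun u hu => by
    obtain ⟨ε, hε, hpos⟩ := ((eventually_add_smul_mem_polyhedron (w := ((0 : E), u)) hy.1
      fun k hk => (hu k hk).le).and self_mem_nhdsWithin).exists
    have hpos' : (0 : ℝ) < ε := hpos
    have hle := hy.2 (y + ε • u) (by simpa using hε)
    simp only [map_add, map_smul, smul_eq_mul] at hle
    exact nonneg_of_mul_nonneg_right (by linarith) hpos'
  have h1 := key w hw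
  have h2 := key (-w) fun k hk => by
    have h : ((0 : E), -w) = -((0 : E), w) := by simp
    rw [h, map_neg, hw k hk, neg_zero]
  rw [map_neg] at h2
  exact hlw (by linarith)

/-- The midpoint of two minimizers is a minimizer whose active constraints are tight at both ends,
so their difference vanishes by genericity. -/
lemma IsGenericObjective.subsingleton_fiberArgmin [Finite K] {l : F →L[ℝ] ℝ}
    (hl : IsGenericObjective g l) (x : E) : (fiberArgmin g b l x).Subsingleton := by
  intro y hy z hz
  have hyz : l y = l z := le_antisymm (hy.2 z hz.1) (hz.2 y hy.1)
  have hmid : ((x, (1 / 2 : ℝ) • y + (1 / 2 : ℝ) • z) : E × F) =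
      (1 / 2 : ℝ) • (x, y) + (1 / 2 : ℝ) • (x, z) := by
    ext1
    · simp only [Prod.fst_add, Prod.smul_fst]
      module
    · simp
  have hm : (1 / 2 : ℝ) • y + (1 / 2 : ℝ) • z ∈ fiberArgmin g b l x := by
    refine ⟨?_, fun w hw => ?_⟩
    · rw [hmid]
      exact convex_polyhedron hy.1 hz.1 (by norm_num) (by norm_num) (by norm_num)
    · have := hy.2 w hw
      simp only [map_add, map_smul, smul_eq_mul]
      linarith
  refine sub_eq_zero.1 (hl.eq_zero_of_activeSet hm fun k hk => ?_)
  have h1 := hy.1 k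
  have h2 := hz.1 k
  rw [activeSet, Set.mem_ofPred_eq, hmid] at hk
  simp only [map_add, map_smul, smul_eq_mul] at hk
  have h : ((0 : E), y - z) = (x, y) - (x, z) := by simp
  rw [h, map_sub]
  linarith

/-- Over the projection of the face cut out by the constraints active at a minimizer of a generic
functional, the minimizer depends affinely on the parameter. -/
lemma IsGenericObjective.exists_affine [Finite K] {l : F →L[ℝ] ℝ}
    (hl : IsGenericObjective g l) {x : E} {y : F} (hy : y ∈ fiberArgmin g b l x)
    (h : F →ₗ[ℝ] ℝ) :
    ∃ (φ : E →ₗ[ℝ] ℝ) (a : ℝ), ∀ z w,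
      (z, w) ∈ polyhedronFace g b (activeSet g b (x, y)) → h w = φ z + a := by
  set J := activeSet g b (x, y) with hJ
  let A : E →ₗ[ℝ] (J → ℝ) := LinearMap.pi fun k => (g k : (E × F) →ₗ[ℝ] ℝ) ∘ₗ LinearMap.inl ℝ E F
  let B : F →ₗ[ℝ] (J → ℝ) := LinearMap.pi fun k => (g k : (E × F) →ₗ[ℝ] ℝ) ∘ₗ LinearMap.inr ℝ E F
  -- On the face the tight constraints read `A z + B w = b`; genericity makes `B` injective, and a
  -- left inverse solves for `w`.
  have hB : LinearMap.ker B = ⊥ := by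
    refine LinearMap.ker_eq_bot'.2 fun v hv => hl.eq_zero_of_activeSet hy fun k hk => ?_
    simpa [B] using congrFun hv ⟨k, hk⟩
  obtain ⟨L, hL⟩ := B.exists_leftInverse_of_injective hB
  refine ⟨-(h ∘ₗ L ∘ₗ A), h (L fun k => b k), fun z w hzw => ?_⟩
  have hBw : B w = (fun k : J => b k) - A z := by
    ext k
    have h1 := hzw.2 k k.2
    have h2 : ((z, w) : E × F) = (z, 0) + (0, w) := by simp
    rw [h2, map_add] at h1
    simp only [B, A, LinearMap.pi_apply, LinearMap.comp_apply, LinearMap.inl_apply,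
      LinearMap.inr_apply, ContinuousLinearMap.coe_coe, Pi.sub_apply]
    linarith
  have hw : w = L (B w) := (LinearMap.congr_fun hL w).symm
  rw [hw, hBw, map_sub, map_sub]
  simp only [LinearMap.neg_apply, LinearMap.comp_apply]
  ring

end Parametric

/-! ### The chamber complex of a polyhedron -/

section ChamberComplex

variable {K : Type*} {nx ny : ℕ}
  {g : K → (EuclideanSpace ℝ (Fin nx) × EuclideanSpace ℝ (Fin ny)) →L[ℝ] ℝ} {b : K → ℝ}

lemma mem_chamber_self (D : Set (EuclideanSpace ℝ (Fin nx) × EuclideanSpace ℝ (Fin ny)))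
    (x : EuclideanSpace ℝ (Fin nx)) : x ∈ chamber D x := by
  rintro _ ⟨F, -, -, hx⟩
  exact hx

lemma mem_chamber_polyhedron_iff [Finite K] {x z : EuclideanSpace ℝ (Fin nx)} :
    z ∈ chamber (polyhedron g b) x ↔
      ∀ J, x ∈ Prod.fst '' polyhedronFace g b J → z ∈ Prod.fst '' polyhedronFace g b J := by
  constructor
  · intro hz J hx
    exact hz _ ⟨_, isExposed_polyhedronFace J, rfl, hx⟩
  · rintro h _ ⟨F, hF, rfl, hx⟩
    obtain ⟨J, rfl⟩ := hF.exists_eq_polyhedronFace (Set.Nonempty.of_image ⟨x, hx⟩)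
    exact h J hx

lemma convex_chamber_polyhedron (x : EuclideanSpace ℝ (Fin nx)) :
    Convex ℝ (chamber (polyhedron g b) x) := by
  refine convex_sInter ?_
  rintro _ ⟨F, hF, rfl, -⟩
  exact (hF.convex convex_polyhedron).linear_image (LinearMap.fst ℝ _ _)

lemma finite_chamberComplex_polyhedron [Finite K] :
    (chamberComplex (polyhedron g b)).Finite := by
  refine (Set.finite_range fun S : Set (Set K) =>
    ⋂ J ∈ S, Prod.fst '' polyhedronFace g b J).subset ?_
  rintro _ ⟨x, -, rfl⟩
  refine ⟨{J | x ∈ Prod.fst '' polyhedronFace g b J}, Set.ext fun z => ?_⟩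
  rw [mem_chamber_polyhedron_iff]
  simp only [Set.mem_iInter, Set.mem_ofPred_eq]

/-- Segments ending at `x` are prolonged by lifting them to faces of the polyhedron; finitely many
`J` leave a common `ε`. -/
lemma mem_intrinsicInterior_chamber_polyhedron [Finite K] (x : EuclideanSpace ℝ (Fin nx)) :
    x ∈ intrinsicInterior ℝ (chamber (polyhedron g b) x) := by
  refine mem_intrinsicInterior_of_forall_exists (convex_chamber_polyhedron x)
    (mem_chamber_self _ x) fun q hq => ?_
  rw [mem_chamber_polyhedron_iff] at hq
  have hev : ∀ᶠ ε in 𝓝[>] (0 : ℝ), ∀ J, x ∈ Prod.fst '' polyhedronFace g b J →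
      x + ε • (x - q) ∈ Prod.fst '' polyhedronFace g b J := by
    refine eventually_all.2 fun J => ?_
    by_cases hJ : x ∈ Prod.fst '' polyhedronFace g b J
    · obtain ⟨p, hp, hpx⟩ := hJ
      -- The lift of `q` is taken in the face of all constraints active at `p`, not just those in
      -- `J`, so that prolonging beyond `p` stays feasible.
      obtain ⟨p', hp', hpq⟩ := hq _ ⟨p, mem_polyhedronFace_activeSet hp.1, hpx⟩
      filter_upwards [eventually_add_smul_sub_mem_polyhedronFace hp.1 hp'] with ε hε _
      exact ⟨_, ⟨hε.1, fun k hk => hε.2 k (hp.2 k hk)⟩, by simp [hpx, hpq]⟩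
    · exact Eventually.of_forall fun ε h => absurd h hJ
  obtain ⟨ε, hε, hpos⟩ := (hev.and self_mem_nhdsWithin).exists
  exact ⟨ε, hpos, mem_chamber_polyhedron_iff.2 hε⟩

/-- The relative interiors of the chambers are disjoint. -/
lemma chamber_eq_of_mem_intrinsicInterior [Finite K] (hD : IsCompact (polyhedron g b))
    {x x' : EuclideanSpace ℝ (Fin nx)} (hx' : x' ∈ leaderSet (polyhedron g b))
    (hx : x ∈ intrinsicInterior ℝ (chamber (polyhedron g b) x')) :
    chamber (polyhedron g b) x = chamber (polyhedron g b) x' := by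
  have hxC := intrinsicInterior_subset hx
  obtain ⟨ε, hε, hz⟩ := exists_pos_add_smul_sub_mem_of_mem_intrinsicInterior hx
    (mem_chamber_self (polyhedron g b) x')
  rw [mem_chamber_polyhedron_iff] at hxC hz
  suffices h : ∀ J, x ∈ Prod.fst '' polyhedronFace g b J →
      x' ∈ Prod.fst '' polyhedronFace g b J by
    ext w
    rw [mem_chamber_polyhedron_iff, mem_chamber_polyhedron_iff]
    exact ⟨fun hw J hJ => hw J (hxC J hJ), fun hw J hJ => hw J (h J hJ)⟩
  exact fun J hJ => mem_image_fst_polyhedronFace_of_prolongation hD hx' hε hz hJ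

/-- A function that agrees with an affine function on every set of points with a common chamber is
piecewise linear over the chamber complex. -/
lemma isPiecewiseLinearOverChambers_polyhedron [Finite K] (hD : IsCompact (polyhedron g b))
    (f : leaderSet (polyhedron g b) → ℝ)
    (hf : ∀ C ∈ chamberComplex (polyhedron g b),
      ∃ (φ : EuclideanSpace ℝ (Fin nx) →ₗ[ℝ] ℝ) (a : ℝ), ∀ x : leaderSet (polyhedron g b),
        chamber (polyhedron g b) x = C → f x = φ x + a) :
    IsPiecewiseLinearOverChambers (polyhedron g b) f := by
  classical
  refine ⟨finite_chamberComplex_polyhedron, ?_⟩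
  choose! φ a hfa using hf
  refine ⟨fun C => (InnerProductSpace.toDual ℝ _).symm (φ C).toContinuousLinearMap, a,
    fun x => ?_⟩
  have hxC : chamber (polyhedron g b) x ∈ chamberComplex (polyhedron g b) :=
    Set.mem_image_of_mem _ x.2
  rw [finsum_mem_eq_finite_toFinset_sum _ finite_chamberComplex_polyhedron,
    Finset.sum_eq_single (chamber (polyhedron g b) x)]
  · rw [Set.indicator_of_mem (mem_intrinsicInterior_chamber_polyhedron _),
      InnerProductSpace.toDual_symm_apply, hfa _ hxC x rfl]
    simp
  · intro C hC hne
    obtain ⟨x', hx', rfl⟩ := (Set.Finite.mem_toFinset _).1 hC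
    exact Set.indicator_of_notMem
      (fun hmem => hne (chamber_eq_of_mem_intrinsicInterior hD hx' hmem).symm) _
  · intro h
    exact absurd ((Set.Finite.mem_toFinset _).2 hxC) h

/-- The minimizers of a generic functional are affine on each chamber. -/
lemma IsGenericObjective.exists_affine_of_chamber [Finite K]
    {l : EuclideanSpace ℝ (Fin ny) →L[ℝ] ℝ} (hl : IsGenericObjective g l)
    {y : leaderSet (polyhedron g b) → EuclideanSpace ℝ (Fin ny)}
    (hy : ∀ x : leaderSet (polyhedron g b), y x ∈ fiberArgmin g b l x)
    (h : EuclideanSpace ℝ (Fin ny) →ₗ[ℝ] ℝ)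
    {C : Set (EuclideanSpace ℝ (Fin nx))} (hC : C ∈ chamberComplex (polyhedron g b)) :
    ∃ (φ : EuclideanSpace ℝ (Fin nx) →ₗ[ℝ] ℝ) (a : ℝ), ∀ x : leaderSet (polyhedron g b),
      chamber (polyhedron g b) x = C → h (y x) = φ x + a := by
  obtain ⟨x₀, hx₀, rfl⟩ := hC
  obtain ⟨φ, a, hφ⟩ := hl.exists_affine (hy ⟨x₀, hx₀⟩) h
  refine ⟨φ, a, fun x hx => ?_⟩
  have hmem : (x : EuclideanSpace ℝ (Fin nx)) ∈ chamber (polyhedron g b) x₀ :=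
    hx ▸ mem_chamber_self _ _
  obtain ⟨⟨_, w⟩, hw, rfl⟩ := mem_chamber_polyhedron_iff.1 hmem _
    ⟨_, mem_polyhedronFace_activeSet (hy ⟨x₀, hx₀⟩).1, rfl⟩
  rw [hl.subsingleton_fiberArgmin _ (hy x)
    (mem_fiberArgmin_of_mem_polyhedronFace (hy ⟨x₀, hx₀⟩) hw)]
  exact hφ _ w hw

end ChamberComplex

/-! ### Almost sure genericity -/

section Genericity

/-- A great subsphere is negligible for the Hausdorff measure of the dimension of the sphere. -/
lemma hausdorffMeasure_sphere_inter_orthogonal {n : ℕ} {v : EuclideanSpace ℝ (Fin n)}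
    (hv : v ≠ 0) :
    Measure.hausdorffMeasure ((n : ℝ) - 1)
      {u : Metric.sphere (0 : EuclideanSpace ℝ (Fin n)) 1 |
        inner ℝ (u : EuclideanSpace ℝ (Fin n)) v = 0} = 0 := by
  have hdim : Module.finrank ℝ (ℝ ∙ v)ᗮ + 1 = n := by
    have h := (ℝ ∙ v).finrank_add_finrank_orthogonal
    rw [finrank_span_singleton hv, finrank_euclideanSpace_fin] at h
    omega
  -- In this dimension the Hausdorff measure on the hyperplane orthogonal to `v` is a Haar measure,
  -- for which the unit sphere is null, even when `n = 1` and that sphere is empty.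
  have hd : (n : ℝ) - 1 = Module.finrank ℝ (ℝ ∙ v)ᗮ := by
    rw [← Nat.cast_inj (R := ℝ)] at hdim
    push_cast at hdim
    linarith
  rw [hd, ← isometry_subtype_coe.hausdorffMeasure_image (Or.inl (Nat.cast_nonneg _))]
  have hsub : ((↑) '' {u : Metric.sphere (0 : EuclideanSpace ℝ (Fin n)) 1 |
        inner ℝ (u : EuclideanSpace ℝ (Fin n)) v = 0} : Set (EuclideanSpace ℝ (Fin n))) ⊆
      (↑) '' (Metric.sphere (0 : (ℝ ∙ v)ᗮ) 1) := by
    rintro _ ⟨u, hu, rfl⟩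
    refine ⟨⟨u, Submodule.mem_orthogonal_singleton_iff_inner_left.2 hu⟩, ?_, rfl⟩
    simp
  refine measure_mono_null hsub ?_
  rw [isometry_subtype_coe.hausdorffMeasure_image (Or.inl (Nat.cast_nonneg _))]
  exact Measure.addHaar_sphere_of_ne_zero _ _ one_ne_zero

/-- For each `J` one fixed nonzero direction `v` suffices: almost surely the cost is not orthogonal
to it. -/
lemma HasNonatomicDistribution.ae_isGenericObjective {K E : Type*} [Finite K]
    [NormedAddCommGroup E] [NormedSpace ℝ E] {n : ℕ}
    (g : K → (E × EuclideanSpace ℝ (Fin n)) →L[ℝ] ℝ)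
    {Ω : Type*} [MeasurableSpace Ω] {μ : Measure Ω}
    {c : Ω → Metric.sphere (0 : EuclideanSpace ℝ (Fin n)) 1}
    (hna : HasNonatomicDistribution μ c)
    {Ω' : Type*} [MeasurableSpace Ω'] {ν : Measure Ω'}
    {c' : Ω' → Metric.sphere (0 : EuclideanSpace ℝ (Fin n)) 1} (hident : IdentDistrib c' c ν μ) :
    ∀ᵐ ω ∂ν, IsGenericObjective g (innerSL ℝ (c' ω : EuclideanSpace ℝ (Fin n))) := by
  refine ae_all_iff.2 fun J => ?_
  by_cases hJ : ∃ v : EuclideanSpace ℝ (Fin n), v ≠ 0 ∧ ∀ k ∈ J, g k (0, v) = 0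
  · obtain ⟨v, hv0, hv⟩ := hJ
    let O : Set (Metric.sphere (0 : EuclideanSpace ℝ (Fin n)) 1) :=
      {u | inner ℝ (u : EuclideanSpace ℝ (Fin n)) v = 0}
    have hO : MeasurableSet O := (isClosed_eq (by fun_prop) continuous_const).measurableSet
    have hnull : ν (c' ⁻¹' O) = 0 := by
      rw [hident.measure_mem_eq hO]
      exact hna O hO (hausdorffMeasure_sphere_inter_orthogonal hv0)
    filter_upwards [measure_eq_zero_iff_ae_notMem.1 hnull] with ω hω _
    exact ⟨v, hv, hω⟩
  · exact Eventually.of_forall fun ω h => absurd h hJ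

end Genericity

/-! ### Bilevel problems -/

namespace BilevelData

variable {nx ny ml mf : ℕ} (P : BilevelData nx ny ml mf)

/-- The left-hand sides of the constraints of the high-point relaxation. -/
noncomputable def constraint : Fin ml ⊕ Fin mf →
    (EuclideanSpace ℝ (Fin nx) × EuclideanSpace ℝ (Fin ny)) →L[ℝ] ℝ :=
  Sum.elim
    (fun k => LinearMap.toContinuousLinearMap
      (LinearMap.proj k ∘ₗ P.Al.mulVecLin ∘ₗ (WithLp.linearEquiv 2 ℝ (Fin nx → ℝ)).toLinearMap ∘ₗ
        LinearMap.fst ℝ _ _))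
    (fun k => LinearMap.toContinuousLinearMap
      (LinearMap.proj k ∘ₗ
        (P.Af.mulVecLin ∘ₗ (WithLp.linearEquiv 2 ℝ (Fin nx → ℝ)).toLinearMap ∘ₗ
            LinearMap.fst ℝ _ _ +
          P.Bf.mulVecLin ∘ₗ (WithLp.linearEquiv 2 ℝ (Fin ny → ℝ)).toLinearMap ∘ₗ
            LinearMap.snd ℝ _ _)))

lemma highPoint_eq_polyhedron :
    P.highPoint = polyhedron P.constraint (Sum.elim P.bl P.bf) := by
  ext p
  simp only [highPoint, polyhedron, Set.mem_ofPred_eq, Sum.forall, Pi.le_def]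
  rfl

/-- The leader's constraints do not involve `y` and hold at every `x` in `X`, so they do not shrink
the follower's feasible set. -/
lemma followerArgmin_eq_fiberArgmin (c : EuclideanSpace ℝ (Fin ny))
    {x : EuclideanSpace ℝ (Fin nx)} (hx : x ∈ leaderSet P.highPoint) :
    P.followerArgmin c x = fiberArgmin P.constraint (Sum.elim P.bl P.bf) (innerSL ℝ c) x := by
  have hmem : ∀ y, y ∈ P.followerSet x ↔
      (x, y) ∈ polyhedron P.constraint (Sum.elim P.bl P.bf) := by
    obtain ⟨p, hp, rfl⟩ := hx
    intro y
    rw [← highPoint_eq_polyhedron]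
    exact ⟨fun hy => ⟨hp.1, hy⟩, fun hy => hy.2⟩
  ext y
  simp only [followerArgmin, fiberArgmin, Set.mem_ofPred_eq, hmem, innerSL_apply_apply]

end BilevelData

theorem theorem2 {nx ny ml mf : ℕ} (P : BilevelData nx ny ml mf)
    (hcompact : IsCompact P.highPoint)
    (hfull : (interior P.highPoint).Nonempty)
    {Ω : Type*} [MeasurableSpace Ω] (μ : Measure Ω) [IsProbabilityMeasure μ]
    (c : Ω → Metric.sphere (0 : EuclideanSpace ℝ (Fin ny)) 1) (hc : Measurable c)
    (hna : HasNonatomicDistribution μ c)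
    {Ω' : Type*} [MeasurableSpace Ω'] (ν : Measure Ω') [IsProbabilityMeasure ν]
    (N : ℕ) (hN : 0 < N)
    (chat : Fin N → Ω' → Metric.sphere (0 : EuclideanSpace ℝ (Fin ny)) 1)
    (hindep : iIndepFun chat ν)
    (hident : ∀ i, IdentDistrib (chat i) c ν μ) :
    ∀ᵐ ω ∂ν,
      ∃ y : Fin N → leaderSet P.highPoint → EuclideanSpace ℝ (Fin ny),
        (∀ i, ∀ x : leaderSet P.highPoint,
          P.followerArgmin (chat i ω : EuclideanSpace ℝ (Fin ny)) x = {y i x}) ∧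
        IsPiecewiseLinearOverChambers P.highPoint
          (fun x => inner ℝ P.d1 (x : EuclideanSpace ℝ (Fin nx))
            + (1 / (N : ℝ)) * ∑ i, inner ℝ P.d2 (y i x)) := by
  have hD := hcompact
  rw [P.highPoint_eq_polyhedron] at hD
  filter_upwards [ae_all_iff.2 fun i => hna.ae_isGenericObjective P.constraint (hident i)]
    with ω hω
  have hex : ∀ i, ∀ x : leaderSet P.highPoint, ∃ y : EuclideanSpace ℝ (Fin ny),
      P.followerArgmin (chat i ω : EuclideanSpace ℝ (Fin ny)) x = {y} := fun i x => by
    rw [P.followerArgmin_eq_fiberArgmin _ x.2]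
    refine Set.exists_eq_singleton_iff_nonempty_subsingleton.2
      ⟨fiberArgmin_nonempty hD _ ?_, (hω i).subsingleton_fiberArgmin _⟩
    rw [← P.highPoint_eq_polyhedron]
    exact x.2
  choose y hy using hex
  refine ⟨y, hy, ?_⟩
  have hy' : ∀ i, ∀ x : leaderSet P.highPoint, y i x ∈ fiberArgmin P.constraint
      (Sum.elim P.bl P.bf) (innerSL ℝ (chat i ω : EuclideanSpace ℝ (Fin ny))) x := fun i x => by
    rw [← P.followerArgmin_eq_fiberArgmin _ x.2, hy i x]
    exact Set.mem_singleton _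
  clear hy hcompact hfull
  revert y
  rw [P.highPoint_eq_polyhedron]
  intro y hy
  refine isPiecewiseLinearOverChambers_polyhedron hD _ fun C hC => ?_
  choose φ a hφ using fun i =>
    (hω i).exists_affine_of_chamber (hy i) (innerSL ℝ P.d2).toLinearMap hC
  refine ⟨(innerSL ℝ P.d1).toLinearMap + (1 / (N : ℝ)) • ∑ i, φ i, (1 / (N : ℝ)) * ∑ i, a i,
    fun x hx => ?_⟩
  have hsum : ∑ i, inner ℝ P.d2 (y i x) = ∑ i, φ i x + ∑ i, a i := by
    rw [← Finset.sum_add_distrib]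
    exact Finset.sum_congr rfl fun i _ => hφ i x hx
  rw [hsum]
  simp only [LinearMap.add_apply, LinearMap.smul_apply, LinearMap.sum_apply, smul_eq_mul,
    ContinuousLinearMap.coe_coe, innerSL_apply_apply]
  ring
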